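/- Let $\mathcal X=[0,1]^d$ with the Euclidean metric, and for Borel probability measures $\mu_1,\mu_2$ on $\mathcal X$ let $$W(\mu_1,\mu_2)=\inf_{\nu\in\Pi(\mu_1,\mu_2)}\int_{\mathcal X\times\mathcal X}\|x-y\|_2\,\nu(dx,dy),$$ where $\Pi(\mu_1,\mu_2)$ is the set of Borel probability measures on $\mathcal X\times\mathcal X$ with marginals $\mu_1$ and $\mu_2$. For integers $L\ge 0$ and $S\ge 1$ let $\Xi(L,S)$ be the set of functions $f:\mathcal X\to\mathbb R$ of the form $$f(x)=A_{L+1}\,\sigma_{b_L}A_L\,\sigma_{b_{L-1}}\cdots A_2\,\sigma_{b_1}A_1x+b_{L+1},$$ where $\sigma_b(y)=\max(y+b,0)$ coordinatewise, the $A_\ell$ are real matrices and the $b_\ell$ real vectors of compatible sizes (hidden layers of arbitrary widths, scalar output), and the total number of nonzero entries of $A_1,b_1,\dots,A_{L+1},b_{L+1}$ is exactly $S$. Let $\Xi^{\mathrm{Lip}}(L,S)$ be the set of $f\in\Xi(L,S)$ with $|f(x)-f(x')|\le\|x-x'\|_2$ for all $x,x'\in\mathcal X$, and let $$\hat W(\mu_1,\mu_2)=\sup_{f\in\Xi^{\mathrm{Lip}}(L,S)}\Big(\int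 f\,d\mu_2-\int f\,d\mu_1\Big).$$ There is an absolute constant $C>0$, and for every $d\ge1$ there is a constant $c>0$ depending only on $d$, such that for every integer $S\ge1$ there is a depth $L\le C(1+S)(1+1/d)$ for which $\Xi^{\mathrm{Lip}}(L,S)$ is nonempty and, for all Borel probability measures $\mu_1,\mu_2$ on $\mathcal X$, $$|\hat W(\mu_1,\mu_2)-W(\mu_1,\mu_2)|\le c\,S^{-1/d}.$$ -/

import Mathlib

open MeasureTheory

noncomputable section

/-- The sample space `[0,1]^d`, with the Euclidean metric. -/
def unitCube (d : ℕ) : Set (EuclideanSpace ℝ (Fin d)) :=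
  {x | ∀ i, x i ∈ Set.Icc (0 : ℝ) 1}

/-- Borel probability measures on `X × X` with marginals `μ₁` and `μ₂`. -/
def couplings {X : Type*} [MeasurableSpace X] (μ₁ μ₂ : Measure X) : Set (Measure (X × X)) :=
  {ν | IsProbabilityMeasure ν ∧ ν.map Prod.fst = μ₁ ∧ ν.map Prod.snd = μ₂}

/-- The Wasserstein distance of order one, as the infimum of the transport cost over couplings. -/
def wasserstein {X : Type*} [MeasurableSpace X] [MetricSpace X] (μ₁ μ₂ : Measure X) : ℝ :=
  sInf ((fun ν : Measure (X × X) => ∫ p, dist p.1 p.2 ∂ν) '' couplings μ₁ μ₂)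

/-- `ReLUNet k n L`: the parameters of a feed-forward network with input dimension `n`, output
dimension `k` and `L` hidden layers of arbitrary widths. -/
inductive ReLUNet (k : ℕ) : ℕ → ℕ → Type
  | output {n : ℕ} (A : Matrix (Fin k) (Fin n) ℝ) (b : Fin k → ℝ) : ReLUNet k n 0
  | hidden {n m L : ℕ} (A : Matrix (Fin m) (Fin n) ℝ) (b : Fin m → ℝ) (N : ReLUNet k m L) :
      ReLUNet k n (L + 1)

namespace ReLUNet

/-- The function computed by a network: every hidden layer maps `x` to `max (A x + b) 0`
(coordinatewise), and the output layer maps `x` to `A x + b`. -/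
def eval {k : ℕ} : {n L : ℕ} → ReLUNet k n L → (Fin n → ℝ) → (Fin k → ℝ)
  | _, _, output A b, x => A.mulVec x + b
  | _, _, hidden A b N, x => N.eval (fun i => max ((A.mulVec x + b) i) 0)

/-- The number of nonzero entries of all weight matrices and all shift vectors. -/
def numParams {k : ℕ} : {n L : ℕ} → ReLUNet k n L → ℕ
  | n, _, output A b =>
      {p : Fin k × Fin n | A p.1 p.2 ≠ 0}.ncard + {i : Fin k | b i ≠ 0}.ncard
  | n, _, hidden (m := m) A b N =>
      {p : Fin m × Fin n | A p.1 p.2 ≠ 0}.ncard + {i : Fin m | b i ≠ 0}.ncard + N.numParams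

end ReLUNet

/-- Functions on `[0,1]^d` computed by a ReLU network with `L` hidden layers and exactly `S`
nonzero parameters. -/
def dnnClass (d L S : ℕ) : Set (unitCube d → ℝ) :=
  {f | ∃ N : ReLUNet 1 d L, N.numParams = S ∧
    ∀ x : unitCube d, f x = N.eval (fun i => (x : EuclideanSpace ℝ (Fin d)) i) 0}

/-- The members of `dnnClass d L S` that are `1`-Lipschitz for the Euclidean metric. -/
def dnnLipClass (d L S : ℕ) : Set (unitCube d → ℝ) :=
  {f | LipschitzWith 1 f} ∩ dnnClass d L S

/-- The Kantorovich dual supremum restricted to `1`-Lipschitz networks. -/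
def dnnWasserstein {d : ℕ} (L S : ℕ) (μ₁ μ₂ : Measure (unitCube d)) : ℝ :=
  sSup ((fun f : unitCube d → ℝ => ∫ x, f x ∂μ₂ - ∫ x, f x ∂μ₁) '' dnnLipClass d L S)

end

/-! By Kantorovich–Rubinstein duality the Wasserstein distance is the supremum of ∫ f dμ₂ - ∫ f dμ₁
over all 1-Lipschitz f. The network supremum runs over fewer functions, so it is no larger, and it
loses only O(η) if each such f is within η of a network in the class, up to an additive constant
(`abs_dnnWasserstein_sub_le`). It remains to reach η of order 2^(-n) with O(2^(dn)) parameters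
inside the 1-Lipschitz functions. Maxima and minima of affine functions of slope at most 1 stay
there, and for fixed d ReLU networks compute them economically.

The heart is `exists_lipNet_scale`, a recursion over dyadic cubes with an asymmetric invariant: the
approximation F is at most f + O(h) on a cube of side 2^k h only, but at least f - O(h) on a ball of
radius about 4^k h. The minimum over the 2^d subcubes keeps the upper bound on the larger cube and
the lower bound on nearly the old ball. The lower bound in the next annulus is supplied by affine
functions that support f from below on the cube: seen from distance 4^k h, the cube subtends an
angle of order 2^(-k), and replacing the norm by a linear function costs distance times angle
squared, again O(h). So 2^((d-1)k) directions suffice, up to constants, and errors do not add up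
across scales. The size is multiplied by 2^d per scale with a geometrically smaller addition, so no
logarithm is lost. -/

noncomputable section

/-! ### Kantorovich–Rubinstein duality on compact metric spaces. -/

section Duality

/-- A pair of functions with `-φ x - ψ y ≤ dist x y` can be replaced by one Lipschitz function. -/
theorem exists_lipschitz_between {X : Type*} [MetricSpace X] [Nonempty X] (φ ψ : X → ℝ)
    (h : ∀ x y, -dist x y ≤ φ x + ψ y) :
    ∃ f : X → ℝ, LipschitzWith 1 f ∧ (∀ x, f x ≤ φ x) ∧ ∀ y, -ψ y ≤ f y := by
  have hbdd : ∀ y, BddBelow (Set.range fun x => dist x y + φ x) := fun y =>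
    ⟨-ψ y, by rintro _ ⟨x, rfl⟩; dsimp only; linarith [h x y]⟩
  -- The inf-convolution of `φ` with the distance.
  refine ⟨fun y => ⨅ x, (dist x y + φ x), LipschitzWith.of_le_add fun y y' => ?_,
    fun x => (ciInf_le (hbdd x) x).trans_eq (by simp), fun y => le_ciInf fun x => by
      linarith [h x y]⟩
  rw [← sub_le_iff_le_add]
  refine le_ciInf fun x => ?_
  have := ciInf_le (hbdd y) x
  have h2 := dist_triangle x y' y
  rw [dist_comm y' y] at h2
  linarith

theorem wasserstein_le_integral {X : Type*} [MetricSpace X] [MeasurableSpace X]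
    {μ₁ μ₂ : Measure X} {ν : Measure (X × X)} (hν : ν ∈ couplings μ₁ μ₂) :
    wasserstein μ₁ μ₂ ≤ ∫ p, dist p.1 p.2 ∂ν :=
  csInf_le ⟨0, by rintro _ ⟨ν, -, rfl⟩; exact integral_nonneg fun _ => dist_nonneg⟩ ⟨ν, hν, rfl⟩

variable {X : Type*} [MetricSpace X] [CompactSpace X] [MeasurableSpace X] [BorelSpace X]

theorem ContinuousMap.integrable_of_isFiniteMeasure (μ : Measure X) [IsFiniteMeasure μ]
    (φ : C(X, ℝ)) : Integrable φ μ :=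
  φ.continuous.integrable_of_hasCompactSupport (HasCompactSupport.of_compactSpace _)

/-- A positive linear functional on the continuous functions of a compact space is integration
against a finite measure. -/
theorem exists_measure_of_positive_functional (Λ : C(X, ℝ) →ₗ[ℝ] ℝ)
    (hΛ : ∀ h : C(X, ℝ), (∀ x, 0 ≤ h x) → 0 ≤ Λ h) :
    ∃ ν : Measure X, IsFiniteMeasure ν ∧ ∀ h : C(X, ℝ), ∫ x, h x ∂ν = Λ h := by
  let Λ₁ : CompactlySupportedContinuousMap X ℝ →ₗ[ℝ] ℝ :=
    { toFun := fun g => Λ g.toContinuousMap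
      map_add' := fun g g' => by rw [← map_add]; rfl
      map_smul' := fun c g => by
        rw [RingHom.id_apply, ← map_smul]; rfl }
  let Λ₂ : CompactlySupportedContinuousMap X ℝ →ₚ[ℝ] ℝ :=
    PositiveLinearMap.mk₀ Λ₁ (fun g hg => hΛ _ hg)
  refine ⟨RealRMK.rieszMeasure Λ₂, ⟨isCompact_univ.measure_lt_top⟩, fun h => ?_⟩
  exact RealRMK.integral_rieszMeasure Λ₂ (CompactlySupportedContinuousMap.continuousMapEquiv h)

/-- The values of the dual transport problem: sums of the integrals of pairs of continuous
functions whose sum dominates `h`. -/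
def dominatingValues (μ₁ μ₂ : Measure X) (h : C(X × X, ℝ)) : Set ℝ :=
  {r | ∃ φ ψ : C(X, ℝ), (∀ x y, h (x, y) ≤ φ x + ψ y) ∧ r = ∫ x, φ x ∂μ₁ + ∫ y, ψ y ∂μ₂}

theorem dominatingValues_nonempty {X : Type*} [MetricSpace X] [CompactSpace X]
    [MeasurableSpace X] (μ₁ μ₂ : Measure X) (h : C(X × X, ℝ)) : (dominatingValues μ₁ μ₂ h).Nonempty :=
  ⟨_, ContinuousMap.const X ‖h‖, 0,
    fun x y => by simpa using (le_abs_self _).trans (h.norm_coe_le_norm (x, y)), rfl⟩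

variable (μ₁ μ₂ : Measure X) [IsProbabilityMeasure μ₁] [IsProbabilityMeasure μ₂]

theorem neg_norm_le_of_mem_dominatingValues {h : C(X × X, ℝ)} {r : ℝ}
    (hr : r ∈ dominatingValues μ₁ μ₂ h) : -‖h‖ ≤ r := by
  obtain ⟨φ, ψ, hφψ, rfl⟩ := hr
  have h1 : ∀ y, -‖h‖ - ψ y ≤ ∫ x, φ x ∂μ₁ := fun y => by
    have := integral_mono (μ := μ₁) (integrable_const (-‖h‖ - ψ y))
      (φ.integrable_of_isFiniteMeasure μ₁) (fun x => by
        have h2 := hφψ x y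
        have h3 := neg_le_of_abs_le (h.norm_coe_le_norm (x, y))
        change -‖h‖ - ψ y ≤ φ x
        linarith)
    simpa using this
  have := integral_mono (μ := μ₂) (integrable_const (-‖h‖ - ∫ x, φ x ∂μ₁))
      (ψ.integrable_of_isFiniteMeasure μ₂) (fun y => by
        change -‖h‖ - _ ≤ ψ y
        linarith [h1 y])
  simp only [integral_const, probReal_univ, smul_eq_mul, one_mul] at this
  linarith

theorem dominatingValues_bddBelow (h : C(X × X, ℝ)) : BddBelow (dominatingValues μ₁ μ₂ h) :=
  ⟨-‖h‖, fun _ hr => neg_norm_le_of_mem_dominatingValues μ₁ μ₂ hr⟩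

/-- The value of the dual transport problem, a sublinear functional. -/
def dualValue (h : C(X × X, ℝ)) : ℝ := sInf (dominatingValues μ₁ μ₂ h)

theorem dualValue_le {h : C(X × X, ℝ)} (φ ψ : C(X, ℝ)) (hφψ : ∀ x y, h (x, y) ≤ φ x + ψ y) :
    dualValue μ₁ μ₂ h ≤ ∫ x, φ x ∂μ₁ + ∫ y, ψ y ∂μ₂ :=
  csInf_le (dominatingValues_bddBelow μ₁ μ₂ h) ⟨φ, ψ, hφψ, rfl⟩

theorem dualValue_smul_le {c : ℝ} (hc : 0 < c) (h : C(X × X, ℝ)) :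
    dualValue μ₁ μ₂ (c • h) ≤ c * dualValue μ₁ μ₂ h := by
  rw [← div_le_iff₀' hc]
  refine le_csInf (dominatingValues_nonempty μ₁ μ₂ h) ?_
  rintro r ⟨φ, ψ, hφψ, rfl⟩
  rw [div_le_iff₀' hc]
  refine (dualValue_le μ₁ μ₂ (c • φ) (c • ψ) fun x y => ?_).trans_eq ?_
  · have := mul_le_mul_of_nonneg_left (hφψ x y) hc.le
    simpa [mul_add] using this
  · simp [integral_const_mul, mul_add]

theorem dualValue_smul {c : ℝ} (hc : 0 < c) (h : C(X × X, ℝ)) :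
    dualValue μ₁ μ₂ (c • h) = c * dualValue μ₁ μ₂ h := by
  refine (dualValue_smul_le μ₁ μ₂ hc h).antisymm ?_
  have := dualValue_smul_le μ₁ μ₂ (inv_pos.2 hc) (c • h)
  rw [smul_smul, inv_mul_cancel₀ hc.ne', one_smul] at this
  rwa [le_inv_mul_iff₀ hc] at this

theorem dualValue_add_le (h h' : C(X × X, ℝ)) :
    dualValue μ₁ μ₂ (h + h') ≤ dualValue μ₁ μ₂ h + dualValue μ₁ μ₂ h' := by
  rw [← sub_le_iff_le_add]
  refine le_csInf (dominatingValues_nonempty μ₁ μ₂ h) ?_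
  rintro r ⟨φ, ψ, hφψ, rfl⟩
  rw [sub_le_comm]
  refine le_csInf (dominatingValues_nonempty μ₁ μ₂ h') ?_
  rintro r ⟨φ', ψ', hφψ', rfl⟩
  rw [sub_le_iff_le_add]
  refine (dualValue_le μ₁ μ₂ (φ + φ') (ψ + ψ') fun x y => ?_).trans_eq ?_
  · have := add_le_add (hφψ x y) (hφψ' x y)
    simp only [ContinuousMap.add_apply]
    linarith
  · simp only [ContinuousMap.add_apply]
    rw [integral_add (φ.integrable_of_isFiniteMeasure μ₁) (φ'.integrable_of_isFiniteMeasure μ₁),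
      integral_add (ψ.integrable_of_isFiniteMeasure μ₂) (ψ'.integrable_of_isFiniteMeasure μ₂)]
    ring

theorem dualValue_zero : dualValue μ₁ μ₂ 0 = 0 := by
  have := dualValue_smul μ₁ μ₂ (c := 2) two_pos 0
  rw [smul_zero] at this
  linarith

/-- This is the domination on the line through `h` that Hahn–Banach needs; for negative `a` it
follows from subadditivity, because the values at `a • h` and `-a • h` have nonnegative sum. -/
theorem mul_dualValue_le (a : ℝ) (h : C(X × X, ℝ)) :
    a * dualValue μ₁ μ₂ h ≤ dualValue μ₁ μ₂ (a • h) := by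
  rcases lt_trichotomy a 0 with ha | rfl | ha
  · have h1 := dualValue_smul μ₁ μ₂ (neg_pos.2 ha) h
    have h2 := dualValue_add_le μ₁ μ₂ (a • h) (-a • h)
    rw [← add_smul, add_neg_cancel, zero_smul, dualValue_zero] at h2
    linarith
  · simp [dualValue_zero]
  · exact (dualValue_smul μ₁ μ₂ ha h).ge

variable [SecondCountableTopology X]

/-- Hahn–Banach: a coupling that attains the dual value of a given continuous function. -/
theorem exists_coupling_integral_eq_dualValue (h : C(X × X, ℝ)) :
    ∃ ν ∈ couplings μ₁ μ₂, ∫ p, h p ∂ν = dualValue μ₁ μ₂ h := by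
  obtain ⟨Λ, hΛh, hΛle⟩ := exists_extension_of_le_sublinear
    (LinearPMap.mkSpanSingleton' (σ := RingHom.id ℝ) h (dualValue μ₁ μ₂ h) (fun c hc => by
      rcases smul_eq_zero.1 hc with rfl | rfl
      · simp
      · simp [dualValue_zero])) (dualValue μ₁ μ₂)
    (fun c hc g => dualValue_smul μ₁ μ₂ hc g) (dualValue_add_le μ₁ μ₂) (by
      rintro ⟨g, hg⟩
      obtain ⟨a, rfl⟩ := Submodule.mem_span_singleton.1 hg
      rw [LinearPMap.mkSpanSingleton'_apply]
      exact mul_dualValue_le μ₁ μ₂ a h)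
  have hval : Λ h = dualValue μ₁ μ₂ h := by
    have := hΛh ⟨h, Submodule.mem_span_singleton_self h⟩
    exact this.trans (LinearPMap.mkSpanSingleton'_apply_self _ _ _ _)
  -- Domination does everything: a nonpositive function is dominated by the pair (0, 0), which gives
  -- positivity, and a function of one coordinate and its negative are dominated by themselves,
  -- which fixes the marginals.
  have hle : ∀ g : C(X × X, ℝ), ∀ φ ψ : C(X, ℝ), (∀ x y, g (x, y) ≤ φ x + ψ y) →
      Λ g ≤ ∫ x, φ x ∂μ₁ + ∫ y, ψ y ∂μ₂ := fun g φ ψ hg =>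
    (hΛle g).trans (dualValue_le μ₁ μ₂ φ ψ hg)
  obtain ⟨ν, hν, hint⟩ := exists_measure_of_positive_functional Λ (fun g hg => by
    have := hle (-g) 0 0 (fun x y => by simpa using hg (x, y))
    simpa using this)
  have hfst : ν.map Prod.fst = μ₁ := by
    refine ext_of_forall_integral_eq_of_IsFiniteMeasure fun φ => ?_
    rw [integral_map measurable_fst.aemeasurable φ.continuous.aestronglyMeasurable]
    have h1 := hint (φ.toContinuousMap.comp ContinuousMap.fst)
    have h2 := hle (φ.toContinuousMap.comp ContinuousMap.fst) φ.toContinuousMap 0 (by simp)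
    have h3 := hle (-(φ.toContinuousMap.comp ContinuousMap.fst)) (-φ.toContinuousMap) 0 (by simp)
    simp [integral_neg] at h1 h2 h3
    linarith
  have hsnd : ν.map Prod.snd = μ₂ := by
    refine ext_of_forall_integral_eq_of_IsFiniteMeasure fun φ => ?_
    rw [integral_map measurable_snd.aemeasurable φ.continuous.aestronglyMeasurable]
    have h1 := hint (φ.toContinuousMap.comp ContinuousMap.snd)
    have h2 := hle (φ.toContinuousMap.comp ContinuousMap.snd) 0 φ.toContinuousMap (by simp)
    have h3 := hle (-(φ.toContinuousMap.comp ContinuousMap.snd)) 0 (-φ.toContinuousMap) (by simp)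
    simp [integral_neg] at h1 h2 h3
    linarith
  have hprob : IsProbabilityMeasure ν := by
    constructor
    have : ν.map Prod.fst Set.univ = 1 := by rw [hfst]; exact measure_univ
    rwa [Measure.map_apply measurable_fst MeasurableSet.univ, Set.preimage_univ] at this
  exact ⟨ν, ⟨hprob, hfst, hsnd⟩, (hint h).trans hval⟩

/-- Kantorovich–Rubinstein duality, the inequality that needs an almost optimal potential. -/
theorem exists_lipschitz_wasserstein_le {ε : ℝ} (hε : 0 < ε) :
    ∃ f : X → ℝ, LipschitzWith 1 f ∧
      wasserstein μ₁ μ₂ ≤ ∫ x, f x ∂μ₂ - ∫ x, f x ∂μ₁ + ε := by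
  have : Nonempty X := nonempty_of_isProbabilityMeasure μ₁
  -- The sign turns the minimal cost into a maximum, which dominating pairs bound from above.
  let c : C(X × X, ℝ) := ⟨fun p => -dist p.1 p.2, by fun_prop⟩
  obtain ⟨ν, hν, hval⟩ := exists_coupling_integral_eq_dualValue μ₁ μ₂ c
  have hcost : ∫ p, dist p.1 p.2 ∂ν = -dualValue μ₁ μ₂ c := by
    rw [← hval, ← integral_neg]
    simp [c]
  obtain ⟨r, ⟨φ, ψ, hφψ, rfl⟩, hr⟩ := exists_lt_of_csInf_lt (dominatingValues_nonempty μ₁ μ₂ c)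
    (lt_add_of_pos_right (dualValue μ₁ μ₂ c) hε)
  obtain ⟨f, hf, hfφ, hfψ⟩ := exists_lipschitz_between φ ψ hφψ
  refine ⟨f, hf, ?_⟩
  have hfi := fun (μ : Measure X) [IsFiniteMeasure μ] =>
    ContinuousMap.integrable_of_isFiniteMeasure μ ⟨f, hf.continuous⟩
  have h1 := integral_mono (hfi μ₁) (φ.integrable_of_isFiniteMeasure μ₁) hfφ
  have h2 := integral_mono (ψ.integrable_of_isFiniteMeasure μ₂).neg (hfi μ₂) hfψ
  simp only [Pi.neg_apply, integral_neg, ContinuousMap.coe_mk] at h1 h2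
  have h3 := wasserstein_le_integral hν
  linarith

theorem integral_sub_integral_le_wasserstein {f : X → ℝ} (hf : LipschitzWith 1 f) :
    ∫ x, f x ∂μ₂ - ∫ x, f x ∂μ₁ ≤ wasserstein μ₁ μ₂ := by
  refine le_csInf ⟨_, μ₁.prod μ₂, ⟨inferInstance, ?_, ?_⟩, rfl⟩ ?_
  · simp
  · simp
  rintro _ ⟨ν, ⟨hν, rfl, rfl⟩, rfl⟩
  have hi : ∀ g : X × X → ℝ, Continuous g → Integrable g ν := fun g hg =>
    ContinuousMap.integrable_of_isFiniteMeasure ν ⟨g, hg⟩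
  rw [integral_map measurable_fst.aemeasurable hf.continuous.aestronglyMeasurable,
    integral_map measurable_snd.aemeasurable hf.continuous.aestronglyMeasurable,
    ← integral_sub (hi (fun p => f p.2) (hf.continuous.comp continuous_snd))
      (hi (fun p => f p.1) (hf.continuous.comp continuous_fst))]
  refine integral_mono (hi _ (by have := hf.continuous; fun_prop)) (hi _ (by fun_prop)) fun p => ?_
  have := hf.dist_le_mul p.2 p.1
  rw [NNReal.coe_one, one_mul, dist_comm p.2 p.1] at this
  exact (le_abs_self _).trans this

end Duality

end

noncomputable section

/-! ### Parameter counting for ReLU networks and for maxima of Lipschitz networks. -/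

section NetworkCalculus

/-- `1` for a nonzero number and `0` for zero. -/
def nonzeroCount (r : ℝ) : ℕ := if r = 0 then 0 else 1

theorem nonzeroCount_zero : nonzeroCount 0 = 0 := by simp [nonzeroCount]

theorem nonzeroCount_le_one (r : ℝ) : nonzeroCount r ≤ 1 := by
  unfold nonzeroCount; split_ifs <;> simp

theorem nonzeroCount_of_ne_zero {r : ℝ} (hr : r ≠ 0) : nonzeroCount r = 1 := by
  simp [nonzeroCount, hr]

theorem nonzeroCount_mul_le (p r : ℝ) : nonzeroCount (p * r) ≤ nonzeroCount r := by
  unfold nonzeroCount; split_ifs <;> simp_all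

theorem nonzeroCount_neg (r : ℝ) : nonzeroCount (-r) = nonzeroCount r := by
  simp [nonzeroCount]

theorem nonzeroCount_add_le (r s : ℝ) :
    nonzeroCount (r + s) ≤ nonzeroCount r + nonzeroCount s := by
  unfold nonzeroCount; split_ifs <;> simp_all

theorem nonzeroCount_linear_le (p q r s : ℝ) :
    nonzeroCount (p * r + q * s) ≤ nonzeroCount r + nonzeroCount s :=
  (nonzeroCount_add_le _ _).trans (add_le_add (nonzeroCount_mul_le p r) (nonzeroCount_mul_le q s))

theorem ncard_ne_zero_eq_sum {ι : Type} [Fintype ι] (b : ι → ℝ) :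
    {i | b i ≠ 0}.ncard = ∑ i, nonzeroCount (b i) := by
  classical
  rw [Set.ncard_eq_toFinset_card', Set.toFinset_ofPred, Finset.card_filter]
  exact Finset.sum_congr rfl fun i _ => by unfold nonzeroCount; split_ifs <;> simp_all

/-- The number of nonzero entries of a row of weights and of its shift. -/
def rowSize {κ : Type} [Fintype κ] (a : κ → ℝ) (b : ℝ) : ℕ :=
  ∑ k, nonzeroCount (a k) + nonzeroCount b

/-- The number of nonzero entries of a layer. -/
def layerSize {ι κ : Type} [Fintype ι] [Fintype κ] (A : ι → κ → ℝ) (b : ι → ℝ) : ℕ :=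
  ∑ i, rowSize (A i) (b i)

theorem ncard_add_ncard_eq_layerSize {m n : ℕ} (A : Fin m → Fin n → ℝ) (b : Fin m → ℝ) :
    {p : Fin m × Fin n | A p.1 p.2 ≠ 0}.ncard + {i | b i ≠ 0}.ncard = layerSize A b := by
  rw [ncard_ne_zero_eq_sum (fun p : Fin m × Fin n => A p.1 p.2), ncard_ne_zero_eq_sum,
    Fintype.sum_prod_type, ← Finset.sum_add_distrib]
  rfl

theorem numParams_hidden {k n m L : ℕ} (A : Fin m → Fin n → ℝ) (b : Fin m → ℝ)
    (N : ReLUNet k m L) : (ReLUNet.hidden A b N).numParams = layerSize A b + N.numParams :=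
  congrArg (· + N.numParams) (ncard_add_ncard_eq_layerSize A b)

theorem numParams_output {k n : ℕ} (A : Fin k → Fin n → ℝ) (b : Fin k → ℝ) :
    (ReLUNet.output A b).numParams = layerSize A b :=
  ncard_add_ncard_eq_layerSize A b

theorem layerSize_reindex {ι ι' κ κ' : Type} [Fintype ι] [Fintype κ] [Fintype ι'] [Fintype κ']
    (e : ι' ≃ ι) (e' : κ' ≃ κ) (A : ι → κ → ℝ) (b : ι → ℝ) :
    layerSize (fun i k => A (e i) (e' k)) (fun i => b (e i)) = layerSize A b := by
  unfold layerSize rowSize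
  rw [← e.sum_comp]
  exact Finset.sum_congr rfl fun i _ => by
    rw [← e'.sum_comp (fun k => nonzeroCount (A (e i) k))]

/-- `AffineFamily d L ι s φ`: the functions `φ i` are the values before activation of the layer
that follows `L` hidden layers of a network with input dimension `d`, where the `L + 1` layers
together have exactly `s` nonzero parameters. -/
def AffineFamily (d : ℕ) : (L : ℕ) → (ι : Type) → [Fintype ι] → ℕ →
    (ι → (Fin d → ℝ) → ℝ) → Prop
  | 0, ι, _, s, φ => ∃ (A : ι → Fin d → ℝ) (b : ι → ℝ), layerSize A b = s ∧
      ∀ i x, φ i x = ∑ k, A i k * x k + b i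
  | L + 1, ι, _, s, φ => ∃ (κ : Type) (_ : Fintype κ) (ψ : κ → (Fin d → ℝ) → ℝ) (s₁ : ℕ)
      (A : ι → κ → ℝ) (b : ι → ℝ), AffineFamily d L κ s₁ ψ ∧ s₁ + layerSize A b = s ∧
      ∀ i x, φ i x = ∑ k, A i k * max (ψ k x) 0 + b i

variable {d : ℕ}

/-- Two networks run side by side with block-diagonal weights; the zero blocks are free, so the
counts add exactly. -/
theorem AffineFamily.sum {L : ℕ} : ∀ {ι ι' : Type} [Fintype ι] [Fintype ι'] {s s' : ℕ}
    {φ : ι → (Fin d → ℝ) → ℝ} {φ' : ι' → (Fin d → ℝ) → ℝ}, AffineFamily d L ι s φ →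
    AffineFamily d L ι' s' φ' → AffineFamily d L (ι ⊕ ι') (s + s') (Sum.elim φ φ') := by
  induction L with
  | zero =>
    rintro ι ι' _ _ s s' φ φ' ⟨A, b, rfl, h⟩ ⟨A', b', rfl, h'⟩
    refine ⟨Sum.elim A A', Sum.elim b b', by simp [layerSize], ?_⟩
    rintro (i | i) x
    · exact h i x
    · exact h' i x
  | succ L ih =>
    rintro ι ι' _ _ s s' φ φ' ⟨κ, _, ψ, s₁, A, b, hψ, rfl, h⟩ ⟨κ', _, ψ', s₁', A', b', hψ', rfl, h'⟩
    refine ⟨κ ⊕ κ', inferInstance, _, _, Sum.elim (fun i => Sum.elim (A i) 0)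
      (fun i => Sum.elim 0 (A' i)), Sum.elim b b', ih hψ hψ', ?_, ?_⟩
    · simp only [layerSize, rowSize, Fintype.sum_sum_type, Sum.elim_inl, Sum.elim_inr,
        Pi.zero_apply, nonzeroCount_zero, Finset.sum_const_zero, add_zero, zero_add]
      ring
    · rintro (i | i) x
      · simpa using h i x
      · simpa using h' i x

theorem affineFamily_empty (L : ℕ) (φ : Empty → (Fin d → ℝ) → ℝ) :
    AffineFamily d L Empty 0 φ := by
  induction L with
  | zero => exact ⟨fun i => i.elim, fun i => i.elim, by simp [layerSize], fun i => i.elim⟩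
  | succ L ih =>
    exact ⟨Empty, inferInstance, φ, 0, fun i => i.elim, fun i => i.elim, ih, by simp [layerSize],
      fun i => i.elim⟩

/-- Padding: a neuron with shift 1 and no incoming weight uses exactly one parameter. -/
theorem affineFamily_one (L t : ℕ) : AffineFamily d L (Fin t) t (fun _ _ => 1) := by
  have h1 : nonzeroCount 1 = 1 := nonzeroCount_of_ne_zero one_ne_zero
  cases L with
  | zero => exact ⟨0, 1, by simp [layerSize, rowSize, nonzeroCount_zero, h1], by simp⟩
  | succ L =>
    exact ⟨Empty, inferInstance, fun i => i.elim, 0, 0, 1, affineFamily_empty L _,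
      by simp [layerSize, rowSize, h1], by simp⟩

/-- A family of activated functions can be put in front of any network. -/
theorem AffineFamily.exists_comp {k : ℕ} {L : ℕ} : ∀ {ι : Type} [Fintype ι] {s : ℕ}
    {φ : ι → (Fin d → ℝ) → ℝ}, AffineFamily d L ι s φ →
    ∀ {m L' : ℕ} (N : ReLUNet k m L') (e : Fin m ≃ ι) (M : ℕ), M = L + 1 + L' →
    ∃ N' : ReLUNet k d M, N'.numParams = s + N.numParams ∧
      ∀ x, N'.eval x = N.eval (fun i => max (φ (e i) x) 0) := by
  induction L with
  | zero =>
    rintro ι _ s φ ⟨A, b, rfl, h⟩ m L' N e M hM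
    obtain rfl : M = L' + 1 := by omega
    refine ⟨.hidden (fun i j => A (e i) j) (fun i => b (e i)) N, ?_, fun x => ?_⟩
    · refine (numParams_hidden _ _ _).trans ?_
      congr 1
      exact layerSize_reindex e (Equiv.refl _) A b
    · simp only [ReLUNet.eval, h]
      rfl
  | succ L ih =>
    rintro ι _ s φ ⟨κ, _, ψ, s₁, A, b, hψ, rfl, h⟩ m L' N e M hM
    let e' : Fin (Fintype.card κ) ≃ κ := (Fintype.equivFin κ).symm
    obtain ⟨N', hN', hev⟩ := ih hψ (.hidden (fun i j => A (e i) (e' j)) (fun i => b (e i)) N) e' M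
      (by omega)
    refine ⟨N', ?_, fun x => ?_⟩
    · have h2 := numParams_hidden (fun i j => A (e i) (e' j)) (fun i => b (e i)) N
      rw [hN', h2, layerSize_reindex e e' A b, add_assoc]
    · rw [hev]
      simp only [ReLUNet.eval, h]
      congr 1
      ext i
      rw [← e'.sum_comp]
      rfl

/-- `ScalarNet d L s r g`: the function `g` is computed by a network with `L` hidden layers that
have at most `s` nonzero parameters and an output layer that has at most `r`. -/
def ScalarNet (d : ℕ) : ℕ → ℕ → ℕ → ((Fin d → ℝ) → ℝ) → Prop
  | 0, _, r, g => ∃ (a : Fin d → ℝ) (b : ℝ), rowSize a b ≤ r ∧ ∀ x, g x = ∑ k, a k * x k + b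
  | L + 1, s, r, g => ∃ (κ : Type) (_ : Fintype κ) (ψ : κ → (Fin d → ℝ) → ℝ) (s₁ : ℕ)
      (a : κ → ℝ) (b : ℝ), AffineFamily d L κ s₁ ψ ∧ s₁ ≤ s ∧ rowSize a b ≤ r ∧
      ∀ x, g x = ∑ k, a k * max (ψ k x) 0 + b

/-- A network with at least one hidden layer can be given any larger number of parameters. -/
theorem ScalarNet.mem_dnnClass {L s r S : ℕ} {g : (Fin d → ℝ) → ℝ}
    (hg : ScalarNet d (L + 1) s r g) (hS : s + r ≤ S) :
    (fun x : unitCube d => g (fun i => (x : EuclideanSpace ℝ (Fin d)) i)) ∈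
      dnnClass d (L + 1) S := by
  obtain ⟨κ, _, ψ, s₁, a, b, hψ, hs, hr, h⟩ := hg
  -- The surplus `t` becomes constant neurons, which the output layer ignores; this makes the count
  -- exactly `S`.
  obtain ⟨t, ht⟩ := Nat.exists_eq_add_of_le (show s₁ + rowSize a b ≤ S by omega)
  let e : Fin (Fintype.card (κ ⊕ Fin t)) ≃ κ ⊕ Fin t := (Fintype.equivFin _).symm
  obtain ⟨N, hN, hev⟩ := (hψ.sum (affineFamily_one L t)).exists_comp
    (ReLUNet.output (k := 1) (fun _ j => Sum.elim a 0 (e j)) (fun _ => b)) e (L + 1) rfl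
  refine ⟨N, ?_, fun x => ?_⟩
  · have h3 := numParams_output (k := 1) (fun _ j => Sum.elim a 0 (e j)) (fun _ => b)
    have h2 := layerSize_reindex (Equiv.refl (Fin 1)) e (fun _ => Sum.elim a 0) (fun _ => b)
    simp only at h2
    rw [hN, h3, h2]
    simp only [layerSize, rowSize, Fintype.sum_sum_type, Sum.elim_inl, Sum.elim_inr,
      Pi.zero_apply, nonzeroCount_zero, Finset.sum_const_zero, Finset.univ_unique,
      Finset.sum_singleton] at ht ⊢
    omega
  · rw [hev]
    simp only [h, ReLUNet.eval, Pi.add_apply, Matrix.mulVec, dotProduct]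
    congr 1
    rw [e.sum_comp (fun j => Sum.elim a 0 j *
      max (Sum.elim ψ (fun _ _ => 1) j fun i => (x : EuclideanSpace ℝ (Fin d)) i) 0)]
    simp

theorem scalarNet_zero (L r : ℕ) : ScalarNet d L 0 r (fun _ => 0) := by
  cases L with
  | zero => exact ⟨0, 0, by simp [rowSize, nonzeroCount_zero], by simp⟩
  | succ L =>
    exact ⟨Empty, inferInstance, fun i => i.elim, 0, 0, 0, affineFamily_empty L _, le_rfl,
      by simp [rowSize, nonzeroCount_zero], by simp⟩

theorem ScalarNet.neg {L s r : ℕ} {g : (Fin d → ℝ) → ℝ} (hg : ScalarNet d L s r g) :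
    ScalarNet d L s r (fun x => -g x) := by
  cases L with
  | zero =>
    obtain ⟨a, b, hr, h⟩ := hg
    refine ⟨fun k => -a k, -b, by simpa [rowSize, nonzeroCount_neg] using hr, fun x => ?_⟩
    simp [h]; ring
  | succ L =>
    obtain ⟨κ, _, ψ, s₁, a, b, hψ, hs, hr, h⟩ := hg
    refine ⟨κ, _, ψ, s₁, fun k => -a k, -b, hψ, hs, by simpa [rowSize, nonzeroCount_neg] using hr,
      fun x => ?_⟩
    simp [h]; ring

/-- Linear combinations of two network functions, as the input of a further layer. -/
theorem ScalarNet.linearCombinations {L s s' r : ℕ} {g h : (Fin d → ℝ) → ℝ}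
    (hg : ScalarNet d L s r g) (hh : ScalarNet d L s' r h) {ι : Type} [Fintype ι] (p q : ι → ℝ) :
    ∃ t ≤ s + s' + Fintype.card ι * (2 * r),
      AffineFamily d L ι t (fun i x => p i * g x + q i * h x) := by
  cases L with
  | zero =>
    obtain ⟨a, b, hr, hg⟩ := hg
    obtain ⟨a', b', hr', hh⟩ := hh
    -- No activation separates the output layers from the combination, so the two affine maps merge
    -- into one row per `i`.
    refine ⟨_, ?_, fun i k => p i * a k + q i * a' k, fun i => p i * b + q i * b', rfl,
      fun i x => ?_⟩
    · have h1 : ∀ i ∈ (Finset.univ : Finset ι),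
          rowSize (fun k => p i * a k + q i * a' k) (p i * b + q i * b') ≤ 2 * r := fun i _ => by
        have h2 := Finset.sum_le_sum fun k (_ : k ∈ (Finset.univ : Finset (Fin d))) =>
          nonzeroCount_linear_le (p i) (q i) (a k) (a' k)
        have h3 := nonzeroCount_linear_le (p i) (q i) b b'
        rw [Finset.sum_add_distrib] at h2
        simp only [rowSize] at *
        omega
      have h4 := Finset.sum_le_card_nsmul _ _ _ h1
      rw [smul_eq_mul, Finset.card_univ] at h4
      exact h4.trans (Nat.le_add_left _ _)
    · simp only [hg, hh, add_mul, Finset.sum_add_distrib, mul_add, Finset.mul_sum, mul_assoc]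
      ring
  | succ L =>
    obtain ⟨κ, _, ψ, s₁, a, b, hψ, hs, hr, hg⟩ := hg
    obtain ⟨κ', _, ψ', s₁', a', b', hψ', hs', hr', hh⟩ := hh
    refine ⟨_, ?_, κ ⊕ κ', inferInstance, Sum.elim ψ ψ', s₁ + s₁',
      fun i => Sum.elim (fun k => p i * a k) (fun k => q i * a' k), fun i => p i * b + q i * b',
      hψ.sum hψ', rfl, fun i x => ?_⟩
    · have h1 : ∀ i ∈ (Finset.univ : Finset ι),
          rowSize (Sum.elim (fun k => p i * a k) (fun k => q i * a' k)) (p i * b + q i * b')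
            ≤ 2 * r := fun i _ => by
        have h2 := Finset.sum_le_sum fun k (_ : k ∈ (Finset.univ : Finset κ)) =>
          nonzeroCount_mul_le (p i) (a k)
        have h2' := Finset.sum_le_sum fun k (_ : k ∈ (Finset.univ : Finset κ')) =>
          nonzeroCount_mul_le (q i) (a' k)
        have h3 := nonzeroCount_linear_le (p i) (q i) b b'
        simp only [rowSize, Fintype.sum_sum_type, Sum.elim_inl, Sum.elim_inr] at *
        omega
      have h4 := Finset.sum_le_card_nsmul _ _ _ h1
      rw [smul_eq_mul, Finset.card_univ] at h4
      exact add_le_add (add_le_add hs hs') h4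
    · simp only [hg, hh, Fintype.sum_sum_type, Sum.elim_inl, Sum.elim_inr, mul_add,
        Finset.mul_sum, mul_assoc]
      ring

/-- max(g, h) = (g - h)⁺ + h⁺ - (-h)⁺: three neurons with at most 2r parameters each, and three
output weights. -/
theorem ScalarNet.max {L s s' r : ℕ} {g h : (Fin d → ℝ) → ℝ} (hr : 3 ≤ r)
    (hg : ScalarNet d L s r g) (hh : ScalarNet d L s' r h) :
    ScalarNet d (L + 1) (s + s' + 6 * r) r (fun x => max (g x) (h x)) := by
  obtain ⟨t, ht, hF⟩ := hg.linearCombinations hh ![1, 0, 0] ![-1, 1, -1]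
  refine ⟨Fin 3, inferInstance, _, t, ![1, 1, -1], 0, hF, ?_, ?_, fun x => ?_⟩
  · rw [Fintype.card_fin] at ht
    omega
  · refine le_trans ?_ hr
    have h0 := nonzeroCount_le_one
    simp only [rowSize, Fin.sum_univ_three, nonzeroCount_zero]
    exact add_le_add (add_le_add (add_le_add (h0 _) (h0 _)) (h0 _)) le_rfl
  · simp only [Fin.sum_univ_three, Matrix.cons_val]
    rcases le_total (g x) (h x) with h1 | h1 <;> rcases le_total (h x) 0 with h2 | h2
    all_goals
      simp only [max_def]
      split_ifs <;> linarith

/-- Since g = g⁺ - (-g)⁺, depth can be added; this equalises depths before a maximum is taken. -/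
theorem ScalarNet.carry {L s r : ℕ} {g : (Fin d → ℝ) → ℝ} (hr : 3 ≤ r)
    (hg : ScalarNet d L s r g) : ScalarNet d (L + 1) (s + 6 * r) r g := by
  obtain ⟨t, ht, hF⟩ := hg.linearCombinations (scalarNet_zero L r) ![1, -1] 0
  refine ⟨Fin 2, inferInstance, _, t, ![1, -1], 0, hF, ?_, ?_, fun x => ?_⟩
  · rw [Fintype.card_fin] at ht
    omega
  · refine le_trans ?_ hr
    have h0 := nonzeroCount_le_one
    simp only [rowSize, Fin.sum_univ_two, nonzeroCount_zero]
    have := h0 (![1, -1] 0)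
    have := h0 (![1, -1] 1)
    omega
  · simp only [Fin.sum_univ_two, Matrix.cons_val, Pi.zero_apply]
    rcases le_total (g x) 0 with h1 | h1
    all_goals
      simp only [max_def]
      split_ifs <;> linarith

/-- `LipNet d L t g`: the `1`-Lipschitz function `g` is computed by a network with `L` hidden
layers, whose parameters are counted in units of `6 * (d + 3)`; the total count is at most `t`. -/
def LipNet (d L t : ℕ) (g : EuclideanSpace ℝ (Fin d) → ℝ) : Prop :=
  LipschitzWith 1 g ∧ ∃ s, s + 6 * (d + 3) ≤ 6 * (d + 3) * t ∧
    ScalarNet d L s (d + 3) (fun x => g (WithLp.toLp 2 x))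

theorem lipNet_affine (u : EuclideanSpace ℝ (Fin d)) (hu : ‖u‖ ≤ 1) (b : ℝ) :
    LipNet d 0 1 (fun x => inner ℝ u x + b) := by
  refine ⟨LipschitzWith.of_dist_le_mul fun x y => ?_, 0, by simp, fun k => u k, b, ?_, fun x => ?_⟩
  · rw [NNReal.coe_one, one_mul, dist_add_right, Real.dist_eq, ← inner_sub_right, dist_eq_norm]
    exact (abs_real_inner_le_norm _ _).trans (mul_le_of_le_one_left (norm_nonneg _) hu)
  · have := Finset.sum_le_card_nsmul Finset.univ (fun k => nonzeroCount (u k)) 1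
      (fun k _ => nonzeroCount_le_one _)
    rw [smul_eq_mul, Finset.card_univ, Fintype.card_fin, mul_one] at this
    have h2 := nonzeroCount_le_one b
    simp only [rowSize]
    omega
  · simp [PiLp.inner_apply, mul_comm]

theorem LipNet.neg {L t : ℕ} {g : EuclideanSpace ℝ (Fin d) → ℝ} (hg : LipNet d L t g) :
    LipNet d L t (fun x => -g x) := by
  obtain ⟨h1, s, hs, h2⟩ := hg
  exact ⟨h1.neg, s, hs, h2.neg⟩

/-- Each `LipNet` holds one unit in reserve. Joining two frees one reserve, which pays for the
layer, so the counts simply add. -/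
theorem LipNet.max {L t t' : ℕ} {g h : EuclideanSpace ℝ (Fin d) → ℝ} (hg : LipNet d L t g)
    (hh : LipNet d L t' h) : LipNet d (L + 1) (t + t') (fun x => max (g x) (h x)) := by
  obtain ⟨h1, s, hs, h2⟩ := hg
  obtain ⟨h1', s', hs', h2'⟩ := hh
  refine ⟨by simpa using h1.max h1', _, ?_, h2.max (by omega) h2'⟩
  rw [mul_add _ t]
  omega

theorem LipNet.carry {L t : ℕ} {g : EuclideanSpace ℝ (Fin d) → ℝ} (hg : LipNet d L t g) (l : ℕ) :
    LipNet d (L + l) (t + l) g := by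
  induction l with
  | zero => exact hg
  | succ l ih =>
    obtain ⟨h1, s, hs, h2⟩ := ih
    refine ⟨h1, _, ?_, h2.carry (by omega)⟩
    rw [← add_assoc t, mul_add _ (t + l), mul_one]
    omega

/-- The halves may coincide: both must be nonempty so that every branch of the tournament in
`LipNet.sup` has the same depth. -/
theorem exists_nonempty_union_of_card_le {α : Type*} [DecidableEq α] {T : Finset α}
    (hT : T.Nonempty) {p : ℕ} (h : T.card ≤ 2 * p) (hp : 1 ≤ p) :
    ∃ T₁ T₂ : Finset α, T₁.Nonempty ∧ T₂.Nonempty ∧ T₁.card ≤ p ∧ T₂.card ≤ p ∧ T₁ ∪ T₂ = T := by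
  rcases le_or_gt T.card p with h1 | h1
  · exact ⟨T, T, hT, hT, h1, h1, Finset.union_self T⟩
  · obtain ⟨T₁, hT₁, hc⟩ := Finset.exists_subset_card_eq h1.le
    have hc2 := Finset.card_sdiff_add_card_eq_card hT₁
    refine ⟨T₁, T \ T₁, Finset.card_pos.1 (by omega), Finset.card_pos.1 (by omega), hc.le,
      by omega, Finset.union_sdiff_of_subset hT₁⟩

theorem LipNet.sup {α : Type*} {L t p : ℕ} {g : α → EuclideanSpace ℝ (Fin d) → ℝ} :
    ∀ {T : Finset α} (hT : T.Nonempty), T.card ≤ 2 ^ p → (∀ i ∈ T, LipNet d L t (g i)) →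
    LipNet d (L + p) (2 ^ p * t) (fun x => T.sup' hT (fun i => g i x)) := by
  classical
  induction p with
  | zero =>
    intro T hT hc hg
    obtain ⟨i, rfl⟩ := Finset.card_eq_one.1 (le_antisymm hc hT.card_pos)
    simpa using hg i (by simp)
  | succ p ih =>
    intro T hT hc hg
    obtain ⟨T₁, T₂, h₁, h₂, hc₁, hc₂, rfl⟩ :=
      exists_nonempty_union_of_card_le hT (by rwa [pow_succ'] at hc) Nat.one_le_two_pow
    have := (ih h₁ hc₁ fun i hi => hg i (Finset.mem_union_left _ hi)).max
      (ih h₂ hc₂ fun i hi => hg i (Finset.mem_union_right _ hi))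
    rw [← two_mul, ← mul_assoc, ← pow_succ', add_assoc] at this
    simpa only [Finset.sup'_union h₁ h₂] using this

theorem LipNet.inf {α : Type*} {L t p : ℕ} {g : α → EuclideanSpace ℝ (Fin d) → ℝ}
    {T : Finset α} (hT : T.Nonempty) (hc : T.card ≤ 2 ^ p) (hg : ∀ i ∈ T, LipNet d L t (g i)) :
    LipNet d (L + p) (2 ^ p * t) (fun x => T.inf' hT (fun i => g i x)) := by
  have := (LipNet.sup hT hc fun i hi => (hg i hi).neg).neg
  convert this using 2 with x
  refine le_antisymm ?_ ?_
  · rw [le_neg]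
    exact Finset.sup'_le _ _ fun i hi => neg_le_neg (Finset.inf'_le _ hi)
  · refine Finset.le_inf' _ _ fun i hi => ?_
    rw [neg_le]
    exact Finset.le_sup' (fun i => -g i x) hi

theorem LipNet.mem_dnnLipClass {L t S : ℕ} {g : EuclideanSpace ℝ (Fin d) → ℝ}
    (hg : LipNet d (L + 1) t g) (hS : 6 * (d + 3) * t ≤ S) :
    (fun x : unitCube d => g x) ∈ dnnLipClass d (L + 1) S := by
  obtain ⟨h1, s, hs, h2⟩ := hg
  have h3 := h1.comp (LipschitzWith.subtype_val (unitCube d))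
  rw [mul_one] at h3
  exact ⟨h3, h2.mem_dnnClass (by omega)⟩

theorem zero_mem_dnnLipClass (L S : ℕ) : (fun _ : unitCube d => 0) ∈ dnnLipClass d (L + 1) S :=
  ⟨LipschitzWith.const' 0, (scalarNet_zero (L + 1) 0).mem_dnnClass (Nat.zero_le _)⟩

end NetworkCalculus

end

noncomputable section

/-! ### Nets of the unit sphere from grids on the faces of a cube. -/

section SphereNet

variable {d : ℕ}

theorem EuclideanSpace.norm_le_sqrt_mul {x : EuclideanSpace ℝ (Fin d)} {r : ℝ} (hr : 0 ≤ r)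
    (hx : ∀ i, |x i| ≤ r) : ‖x‖ ≤ √d * r := by
  rw [EuclideanSpace.norm_eq, ← Real.sqrt_sq hr, ← Real.sqrt_mul (Nat.cast_nonneg d)]
  refine Real.sqrt_le_sqrt ?_
  have := Finset.sum_le_card_nsmul Finset.univ (fun i => ‖x i‖ ^ 2) (r ^ 2) fun i _ => by
    rw [Real.norm_eq_abs]
    exact pow_le_pow_left₀ (abs_nonneg _) (hx i) 2
  simpa using this

/-- Dividing by ‖w‖ ≥ 1 does not increase distances, and correcting `a` to ‖w‖ costs at most ‖w - a
• v‖ once more. -/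
theorem norm_normalize_sub_le {E : Type*} [NormedAddCommGroup E] [NormedSpace ℝ E] {w v : E}
    {a : ℝ} (ha : 0 ≤ a) (hw : 1 ≤ ‖w‖) (hv : ‖v‖ = 1) :
    ‖‖w‖⁻¹ • w - v‖ ≤ 2 * ‖w - a • v‖ := by
  have h0 : 0 < ‖w‖ := by linarith
  have h1 : ‖w‖⁻¹ • w - v = ‖w‖⁻¹ • ((w - a • v) + (a - ‖w‖) • v) := by
    rw [sub_smul, sub_add_sub_cancel, smul_sub, smul_smul, inv_mul_cancel₀ h0.ne', one_smul]
  have h2 : |a - ‖w‖| ≤ ‖w - a • v‖ := by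
    have := abs_norm_sub_norm_le (a • v) w
    rwa [norm_smul, hv, mul_one, Real.norm_eq_abs, abs_of_nonneg ha, norm_sub_rev] at this
  rw [h1, norm_smul, norm_inv, norm_norm]
  refine (mul_le_of_le_one_left (norm_nonneg _) (inv_le_one_of_one_le₀ hw)).trans ?_
  refine (norm_add_le _ _).trans ?_
  rw [norm_smul, hv, mul_one, Real.norm_eq_abs]
  linarith

theorem exists_fin_abs_sub_le_one {n : ℕ} (hn : 1 ≤ n) {z : ℝ} (h0 : 0 ≤ z) (h1 : z ≤ n) :
    ∃ m : Fin n, |(m : ℝ) - z| ≤ 1 := by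
  rcases h1.lt_or_eq with h1 | rfl
  · refine ⟨⟨⌊z⌋₊, (Nat.floor_lt h0).2 h1⟩, ?_⟩
    rw [abs_le]
    have h2 := Nat.floor_le h0
    have h3 := Nat.lt_floor_add_one z
    constructor <;> dsimp only <;> linarith
  · refine ⟨⟨n - 1, by omega⟩, ?_⟩
    simp [Nat.cast_sub hn]

/-- A point of the grid of mesh `2 ^ (-k)` on the face of the cube `[-1, 1] ^ (D + 1)` where the
coordinate `j` is `1` or `-1`. -/
def faceGridPoint {D : ℕ} (k : ℕ) (j : Fin (D + 1)) (σ : Bool) (m : Fin D → Fin (2 ^ (k + 1))) :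
    EuclideanSpace ℝ (Fin (D + 1)) :=
  WithLp.toLp 2 (j.insertNth (if σ then (1 : ℝ) else -1) (fun i => -1 + (m i : ℝ) / 2 ^ k))

theorem one_le_norm_faceGridPoint {D : ℕ} (k : ℕ) (j : Fin (D + 1)) (σ : Bool)
    (m : Fin D → Fin (2 ^ (k + 1))) : 1 ≤ ‖faceGridPoint k j σ m‖ := by
  refine le_trans ?_ (PiLp.norm_apply_le (faceGridPoint k j σ m) j)
  cases σ <;> simp [faceGridPoint]

/-- Scaling `v` until its largest coordinate is ±1 puts it on a face; the other coordinates are then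
rounded to the grid. -/
theorem exists_faceGridPoint_near {D : ℕ} (k : ℕ) {v : EuclideanSpace ℝ (Fin (D + 1))}
    (hv : ‖v‖ = 1) : ∃ j σ m, ∃ a : ℝ, 0 ≤ a ∧
      ‖faceGridPoint k j σ m - a • v‖ ≤ √(D + 1 : ℕ) * (1 / 2 ^ k) := by
  obtain ⟨j, -, hj⟩ := Finset.exists_max_image Finset.univ (fun i => |v i|) Finset.univ_nonempty
  have hvj : 0 < |v j| := by
    by_contra! h
    have h2 := EuclideanSpace.norm_le_sqrt_mul (x := v) le_rfl
      (fun i => (hj i (Finset.mem_univ i)).trans h)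
    rw [hv, mul_zero] at h2
    linarith
  have hle : ∀ i, |(|v j|⁻¹ • v) i| ≤ 1 := fun i => by
    rw [PiLp.smul_apply, smul_eq_mul, abs_mul, abs_inv, abs_abs, inv_mul_le_one₀ hvj]
    exact hj i (Finset.mem_univ i)
  have hk : (0 : ℝ) < 2 ^ k := by positivity
  have hm : ∀ i : Fin D, ∃ m : Fin (2 ^ (k + 1)),
      |(m : ℝ) - ((|v j|⁻¹ • v) (j.succAbove i) + 1) * 2 ^ k| ≤ 1 := fun i => by
    have h1 := abs_le.1 (hle (j.succAbove i))
    refine exists_fin_abs_sub_le_one Nat.one_le_two_pow (mul_nonneg (by linarith) hk.le) ?_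
    rw [Nat.cast_pow, pow_succ', Nat.cast_ofNat]
    exact mul_le_mul_of_nonneg_right (by linarith) hk.le
  choose m hm using hm
  refine ⟨j, decide (0 < v j), m, |v j|⁻¹, by positivity,
    EuclideanSpace.norm_le_sqrt_mul (by positivity) fun i => ?_⟩
  rcases Fin.eq_self_or_eq_succAbove j i with rfl | ⟨i, rfl⟩
  · have h0 : v i ≠ 0 := abs_pos.1 hvj
    rcases lt_or_gt_of_ne h0 with h | h
    · have : ¬ 0 < v i := h.not_gt
      simp [faceGridPoint, this, abs_of_neg h, inv_neg, h0]
    · simp [faceGridPoint, h, abs_of_pos h, h0]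
  · rw [le_div_iff₀ hk]
    nth_rewrite 1 [← abs_of_pos hk]
    rw [← abs_mul]
    have h1 : (faceGridPoint k j (decide (0 < v j)) m - |v j|⁻¹ • v) (j.succAbove i) * 2 ^ k =
        (m i : ℝ) - ((|v j|⁻¹ • v) (j.succAbove i) + 1) * 2 ^ k := by
      have h2 : faceGridPoint k j (decide (0 < v j)) m (j.succAbove i) =
          -1 + (m i : ℝ) / 2 ^ k := by simp [faceGridPoint]
      rw [PiLp.sub_apply, h2]
      field_simp
      ring
    rw [h1]
    exact hm i

/-- A net of the unit sphere whose size grows like the power `d - 1` of the resolution. -/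
theorem exists_sphere_net (hd : 1 ≤ d) (k : ℕ) :
    ∃ N : Finset (EuclideanSpace ℝ (Fin d)), N.Nonempty ∧ N.card ≤ 2 ^ ((d - 1) * k + 2 * d) ∧
      (∀ u ∈ N, ‖u‖ = 1) ∧ ∀ v, ‖v‖ = 1 → ∃ u ∈ N, ‖u - v‖ ≤ 2 * √d / 2 ^ k := by
  classical
  obtain ⟨D, rfl⟩ := Nat.exists_eq_add_of_le' hd
  let P : Fin (D + 1) × Bool × (Fin D → Fin (2 ^ (k + 1))) → EuclideanSpace ℝ (Fin (D + 1)) :=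
    fun p => ‖faceGridPoint k p.1 p.2.1 p.2.2‖⁻¹ • faceGridPoint k p.1 p.2.1 p.2.2
  refine ⟨Finset.univ.image P, Finset.univ_nonempty.image P, Finset.card_image_le.trans ?_, ?_, ?_⟩
  · rw [Finset.card_univ, Fintype.card_prod, Fintype.card_prod, Fintype.card_bool,
      Fintype.card_fun, Fintype.card_fin, Fintype.card_fin, Fintype.card_fin, ← pow_mul]
    calc (D + 1) * (2 * 2 ^ ((k + 1) * D)) ≤ 2 ^ D * (2 * 2 ^ ((k + 1) * D)) :=
          Nat.mul_le_mul_right _ (Nat.lt_two_pow_self (n := D))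
      _ = 2 ^ (D * k + 2 * D + 1) := by ring
      _ ≤ 2 ^ ((D + 1 - 1) * k + 2 * (D + 1)) := Nat.pow_le_pow_right two_pos (by
          rw [Nat.add_sub_cancel]; omega)
  · intro u hu
    obtain ⟨p, -, rfl⟩ := Finset.mem_image.1 hu
    have := one_le_norm_faceGridPoint k p.1 p.2.1 p.2.2
    simp only [P]
    rw [norm_smul, norm_inv, norm_norm, inv_mul_cancel₀ (by linarith)]
  · intro v hv
    obtain ⟨j, σ, m, a, ha, h⟩ := exists_faceGridPoint_near k hv
    refine ⟨P (j, σ, m), Finset.mem_image_of_mem _ (Finset.mem_univ _), ?_⟩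
    refine (norm_normalize_sub_le ha (one_le_norm_faceGridPoint k j σ m) hv).trans ?_
    calc _ ≤ 2 * (√(D + 1 : ℕ) * (1 / 2 ^ k)) := by gcongr
      _ = _ := by ring

end SphereNet

/-! ### Multiscale approximation of a Lipschitz function. -/

section Potential

variable {d : ℕ}

/-- The logarithm of the number of directions that are used on scale `k`. -/
def logDirections (d k : ℕ) : ℕ := (d - 1) * k + 2 * d

/-- The depth of the approximating network of scale `k`. -/
def netDepth (d : ℕ) : ℕ → ℕ
  | 0 => 0
  | k + 1 => netDepth d k + d + logDirections d (k + 1) + 1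

/-- The size of the approximating network of scale `k`. -/
def netSize (d : ℕ) : ℕ → ℕ
  | 0 => 1
  | k + 1 => 2 ^ d * netSize d k + logDirections d (k + 1) +
      (2 ^ logDirections d (k + 1) + (netDepth d k + d))

/-- The cube of side `l` with smallest vertex `q`. -/
def cornerCube (q : EuclideanSpace ℝ (Fin d)) (l : ℝ) : Set (EuclideanSpace ℝ (Fin d)) :=
  {z | ∀ i, z i ∈ Set.Icc (q i) (q i + l)}

theorem norm_sub_le_of_mem_cornerCube {q z : EuclideanSpace ℝ (Fin d)} {l : ℝ} (hl : 0 ≤ l)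
    (hz : z ∈ cornerCube q l) : ‖z - q‖ ≤ √d * l :=
  EuclideanSpace.norm_le_sqrt_mul hl fun i => by
    have := hz i
    rw [PiLp.sub_apply, abs_le]
    constructor <;> linarith [this.1, this.2]

theorem isCompact_cornerCube (q : EuclideanSpace ℝ (Fin d)) {l : ℝ} (hl : 0 ≤ l) :
    IsCompact (cornerCube q l) := by
  refine Metric.isCompact_of_isClosed_isBounded ?_ ?_
  · simp only [cornerCube, Set.mem_Icc, Set.ofPred_forall, Set.ofPred_and]
    exact isClosed_iInter fun i => (isClosed_le (by fun_prop) (by fun_prop)).inter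
      (isClosed_le (by fun_prop) (by fun_prop))
  · refine Metric.isBounded_closedBall (x := q) (r := √d * l) |>.subset fun z hz => ?_
    rw [Metric.mem_closedBall, dist_eq_norm]
    exact norm_sub_le_of_mem_cornerCube hl hz

/-- The smallest vertex of a subcube of half the side. -/
def childCorner (q : EuclideanSpace ℝ (Fin d)) (l : ℝ) (σ : Fin d → Bool) :
    EuclideanSpace ℝ (Fin d) :=
  WithLp.toLp 2 fun i => q i + if σ i then l else 0

theorem norm_childCorner_sub_le (q : EuclideanSpace ℝ (Fin d)) {l : ℝ} (hl : 0 ≤ l)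
    (σ : Fin d → Bool) : ‖childCorner q l σ - q‖ ≤ √d * l :=
  norm_sub_le_of_mem_cornerCube hl fun i => by
    simp only [childCorner]
    split_ifs <;> constructor <;> linarith

theorem exists_mem_child {q z : EuclideanSpace ℝ (Fin d)} {l : ℝ}
    (hz : z ∈ cornerCube q (2 * l)) : ∃ σ, z ∈ cornerCube (childCorner q l σ) l := by
  refine ⟨fun i => decide (q i + l ≤ z i), fun i => ?_⟩
  have := hz i
  by_cases h : q i + l ≤ z i
  · simp only [childCorner, h, decide_true, if_true]
    constructor <;> linarith [this.1, this.2]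
  · simp only [childCorner, h, decide_false, Bool.false_eq_true, if_false]
    constructor <;> linarith [this.1, this.2]

/-- How much is lost in replacing the norm of `x - z` by the inner product with a unit vector close
to the direction of `x - q`, where `q` is close to `z`. -/
theorem norm_sub_inner_le {E : Type*} [NormedAddCommGroup E] [InnerProductSpace ℝ E]
    {u v x z q : E} (hu : ‖u‖ = 1) (hv : x - q = ‖x - q‖ • v) :
    2 * ‖x - z‖ * (‖x - z‖ - inner ℝ u (x - z)) ≤
      (2 * ‖z - q‖ + ‖x - q‖ * ‖u - v‖) ^ 2 := by
  -- As `u` is a unit vector, the defect is a square, which makes the loss quadratic in the angle.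
  have h1 : 2 * ‖x - z‖ * (‖x - z‖ - inner ℝ u (x - z)) = ‖(x - z) - ‖x - z‖ • u‖ ^ 2 := by
    rw [norm_sub_sq_real, norm_smul, hu, inner_smul_right, real_inner_comm, norm_norm]
    ring
  rw [h1]
  refine pow_le_pow_left₀ (norm_nonneg _) ?_ 2
  have h2 : (x - z) - ‖x - z‖ • u =
      -(z - q) + ‖x - q‖ • (v - u) + (‖x - q‖ - ‖x - z‖) • u := by
    rw [smul_sub, ← hv, sub_smul]
    abel
  have h3 : |‖x - q‖ - ‖x - z‖| ≤ ‖z - q‖ := by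
    refine (abs_norm_sub_norm_le _ _).trans_eq ?_
    rw [sub_sub_sub_cancel_left]
  rw [h2]
  refine (norm_add₃_le).trans ?_
  rw [norm_neg, norm_smul, norm_smul, hu, norm_norm, norm_sub_rev v u, Real.norm_eq_abs]
  linarith

/-- In the annulus that belongs to a scale, the tangent planes in the directions of a net give a
lower bound for the norm that is sharp up to the mesh. -/
theorem norm_sub_inner_le_mesh (hd : 1 ≤ d) {u v x z q : EuclideanSpace ℝ (Fin d)} {h t : ℝ}
    (hh : 0 < h) (ht : 1 ≤ t) (hu : ‖u‖ = 1) (hv : x - q = ‖x - q‖ • v)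
    (hz : ‖z - q‖ ≤ √d * (2 * t * h)) (huv : ‖u - v‖ ≤ 2 * √d / (2 * t))
    (hlow : 4 * √d * t ^ 2 * h ≤ ‖x - q‖) (hup : ‖x - q‖ ≤ 5 * √d * (2 * t) ^ 2 * h) :
    ‖x - z‖ - inner ℝ u (x - z) ≤ 144 * d ^ 2 * h := by
  have hd1 : (1 : ℝ) ≤ d := by exact_mod_cast hd
  have hs1 : 1 ≤ √(d : ℝ) := Real.one_le_sqrt.2 hd1
  have hs2 : √(d : ℝ) ^ 2 = d := Real.sq_sqrt (by linarith)
  have hs3 : √(d : ℝ) ≤ d := by nlinarith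
  -- In the application `t` is 2^k. The square is at most (24dth)², where 24 = 4 + 20, and ‖x - z‖
  -- is at least 2t²h, so `t` cancels and 24² / 4 = 144 remains.
  have h1 := norm_sub_inner_le (z := z) hu hv
  have h2 : ‖x - q‖ * ‖u - v‖ ≤ 20 * d * t * h := by
    refine (mul_le_mul hup huv (norm_nonneg _) (by positivity)).trans_eq ?_
    nth_rewrite 3 [← hs2]
    field_simp
    ring
  have h3 : 2 * ‖z - q‖ + ‖x - q‖ * ‖u - v‖ ≤ 24 * d * t * h := by
    have : √(d : ℝ) * (2 * t * h) ≤ d * (2 * t * h) := by gcongr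
    linarith
  have h4 : (2 * ‖z - q‖ + ‖x - q‖ * ‖u - v‖) ^ 2 ≤ (24 * d * t * h) ^ 2 :=
    pow_le_pow_left₀ (by positivity) h3 2
  have h5 : 2 * t ^ 2 * h ≤ ‖x - z‖ := by
    have h6 : ‖x - q‖ ≤ ‖x - z‖ + ‖z - q‖ := by
      simpa using norm_add_le (x - z) (z - q)
    have h7 : √(d : ℝ) * (2 * t * h) ≤ √(d : ℝ) * (2 * t ^ 2 * h) := by
      gcongr
      nlinarith
    have h8 : 1 * (2 * t ^ 2 * h) ≤ √(d : ℝ) * (2 * t ^ 2 * h) := by gcongr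
    linarith
  have h9 : 0 ≤ ‖x - z‖ - inner ℝ u (x - z) := by
    have := real_inner_le_norm u (x - z)
    rw [hu, one_mul] at this
    linarith
  have h10 : 2 * (2 * t ^ 2 * h) * (‖x - z‖ - inner ℝ u (x - z)) ≤ (24 * d * t * h) ^ 2 :=
    le_trans (by gcongr) (h1.trans h4)
  have h11 : 0 < 2 * (2 * t ^ 2 * h) := by positivity
  refine le_of_mul_le_mul_left (h10.trans_eq ?_) h11
  ring

theorem lipNet_const (r : ℝ) : LipNet d 0 1 (fun _ => r) := by
  simpa using lipNet_affine (d := d) 0 (by simp) r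

/-- A potential is approximated on a dyadic cube of side `2 ^ k * h` from above, and on a ball of
radius about `4 ^ k * h` from below, by a maximum of two functions: the minimum of the
approximations on the subcubes, and a maximum of supporting affine functions. -/
theorem exists_lipNet_scale (hd : 1 ≤ d) {h : ℝ} (hh : 0 < h)
    {f : EuclideanSpace ℝ (Fin d) → ℝ} (hf : LipschitzWith 1 f) (k : ℕ) :
    ∀ q : EuclideanSpace ℝ (Fin d), ∃ F, LipNet d (netDepth d k) (netSize d k) F ∧
      (∀ z ∈ cornerCube q (2 ^ k * h), F z ≤ f z + 144 * d ^ 2 * h) ∧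
      ∀ x, ‖x - q‖ ≤ 5 * √d * (2 ^ k) ^ 2 * h → f x - 144 * d ^ 2 * h ≤ F x := by
  have hd1 : (1 : ℝ) ≤ d := by exact_mod_cast hd
  have hs1 : 1 ≤ √(d : ℝ) := Real.one_le_sqrt.2 hd1
  have hs2 : √(d : ℝ) ^ 2 = d := Real.sq_sqrt (by linarith)
  have hs3 : √(d : ℝ) ≤ d ^ 2 := by nlinarith
  have hf' : ∀ x y, f x ≤ f y + ‖x - y‖ := fun x y => by
    have := hf.dist_le_mul x y
    rw [NNReal.coe_one, one_mul, dist_eq_norm x y] at this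
    linarith [(le_abs_self _).trans this]
  induction k with
  | zero =>
    intro q
    have h1 : √(d : ℝ) * h ≤ d ^ 2 * h := by gcongr
    have h2 : 0 ≤ (d : ℝ) ^ 2 * h := by positivity
    refine ⟨fun _ => f q, lipNet_const (f q), fun z hz => ?_, fun x hx => ?_⟩
    · have h3 := norm_sub_le_of_mem_cornerCube (by positivity) hz
      have h4 := hf' q z
      rw [norm_sub_rev] at h4
      simp only [pow_zero, one_mul] at h3
      linarith
    · have h4 := hf' x q
      simp only [pow_zero, one_pow, mul_one] at hx
      linarith
  | succ k ih =>
    intro q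
    have hl : (0 : ℝ) ≤ 2 ^ k * h := by positivity
    have hl' : (0 : ℝ) ≤ 2 ^ (k + 1) * h := by positivity
    have ht : (1 : ℝ) ≤ 2 ^ k := one_le_pow₀ one_le_two
    obtain ⟨N, hN, hNcard, hN1, hNcover⟩ := exists_sphere_net hd (k + 1)
    -- The affine function of slope `u` through (z, f z) then lies below `f` on the whole cube.
    have hmin : ∀ u : EuclideanSpace ℝ (Fin d), ∃ z ∈ cornerCube q (2 ^ (k + 1) * h),
        ∀ z' ∈ cornerCube q (2 ^ (k + 1) * h), f z - inner ℝ u z ≤ f z' - inner ℝ u z' := fun u =>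
      (isCompact_cornerCube q hl').exists_isMinOn ⟨q, fun i => ⟨le_rfl, by linarith⟩⟩
        (hf.continuous.sub (by fun_prop)).continuousOn
    choose z hzQ hz using hmin
    choose F hFnet hFup hFlow using fun σ => ih (childCorner q (2 ^ k * h) σ)
    -- Each branch is padded by the depth of the other one.
    have hmins := (LipNet.inf (p := d) (Finset.univ_nonempty (α := Fin d → Bool)) (by simp)
      fun σ _ => hFnet σ).carry (logDirections d (k + 1))
    have hmaxs := (LipNet.sup (p := logDirections d (k + 1)) hN hNcard fun u hu =>
      lipNet_affine u (hN1 u hu).le (f (z u) - inner ℝ u (z u))).carry (netDepth d k + d)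
    rw [zero_add, mul_one, add_comm (logDirections d (k + 1)) (netDepth d k + d)] at hmaxs
    refine ⟨_, hmins.max hmaxs, fun y hy => max_le ?_ ?_, fun x hx => ?_⟩
    · rw [pow_succ', mul_assoc] at hy
      obtain ⟨σ, hσ⟩ := exists_mem_child hy
      exact (Finset.inf'_le _ (Finset.mem_univ σ)).trans (hFup σ y hσ)
    · refine Finset.sup'_le _ _ fun u hu => ?_
      have := hz u y hy
      have h2 : 0 ≤ 144 * (d : ℝ) ^ 2 * h := by positivity
      linarith
    -- The gap between 4 and 5 absorbs the distance from `q` to the corners of the subcubes.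
    · rcases le_total ‖x - q‖ (4 * √d * (2 ^ k) ^ 2 * h) with hxq | hxq
      · refine le_max_of_le_left (Finset.le_inf' _ _ fun σ _ => hFlow σ x ?_)
        have h1 := norm_childCorner_sub_le q hl σ
        have h2 : ‖x - childCorner q (2 ^ k * h) σ‖ ≤
            ‖x - q‖ + ‖childCorner q (2 ^ k * h) σ - q‖ := by
          simpa using norm_sub_le (x - q) (childCorner q (2 ^ k * h) σ - q)
        have h3 : √d * (2 ^ k * h) ≤ √d * ((2 ^ k) ^ 2 * h) := by
          gcongr
          nlinarith
        linarith
      · have hpos : 0 < ‖x - q‖ := lt_of_lt_of_le (by positivity) hxq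
        have hv : x - q = ‖x - q‖ • (‖x - q‖⁻¹ • (x - q)) := by
          rw [smul_smul, mul_inv_cancel₀ hpos.ne', one_smul]
        obtain ⟨u, hu, huv⟩ := hNcover (‖x - q‖⁻¹ • (x - q)) (by
          rw [norm_smul, norm_inv, norm_norm, inv_mul_cancel₀ hpos.ne'])
        have hzq := norm_sub_le_of_mem_cornerCube hl' (hzQ u)
        rw [pow_succ' (2 : ℝ) k] at hzq huv hx
        have h1 := norm_sub_inner_le_mesh hd hh ht (hN1 u hu) hv hzq huv hxq hx
        refine le_max_of_le_right (le_trans ?_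
          (Finset.le_sup' (fun u => inner ℝ u x + (f (z u) - inner ℝ u (z u))) hu))
        rw [inner_sub_right] at h1
        -- The Lipschitz bound f x ≤ f (z u) + ‖x - z u‖ turns the sharp lower bound for ⟨u, x - z
        -- u⟩ into one for the affine function.
        have h2 := hf' x (z u)
        linarith

theorem exists_lipNet_near (hd : 1 ≤ d) {f : EuclideanSpace ℝ (Fin d) → ℝ}
    (hf : LipschitzWith 1 f) (n : ℕ) :
    ∃ F, LipNet d (netDepth d n) (netSize d n) F ∧
      ∀ x ∈ unitCube d, |F x - f x| ≤ 144 * d ^ 2 * (1 / 2 ^ n) := by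
  obtain ⟨F, hF, hup, hlow⟩ := exists_lipNet_scale hd (h := 1 / 2 ^ n) (by positivity) hf n 0
  have hn : (2 : ℝ) ^ n * (1 / 2 ^ n) = 1 := by field_simp
  refine ⟨F, hF, fun x hx => ?_⟩
  have hx' : x ∈ cornerCube (0 : EuclideanSpace ℝ (Fin d)) (2 ^ n * (1 / 2 ^ n)) := by
    rw [hn]
    simpa [cornerCube, unitCube] using hx
  have h1 := norm_sub_le_of_mem_cornerCube (by positivity) hx'
  have h2 := hup x hx'
  have h3 := hlow x (h1.trans (by
    have : (1 : ℝ) ≤ 2 ^ n := one_le_pow₀ one_le_two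
    have h5 : 0 ≤ √(d : ℝ) := Real.sqrt_nonneg _
    have h4 : 5 * √(d : ℝ) * (2 ^ n) ^ 2 * (1 / 2 ^ n) = 5 * √d * 2 ^ n := by field_simp
    rw [hn, h4]
    nlinarith))
  rw [abs_le]
  constructor <;> linarith

end Potential

end

noncomputable section

/-! ### Size estimates and the rate. -/

section Rate

theorem netDepth_le_netSize (d n : ℕ) : netDepth d n ≤ netSize d n := by
  cases n with
  | zero => simp [netDepth]
  | succ k =>
    have := Nat.one_le_two_pow (n := logDirections d (k + 1))
    simp only [netDepth, netSize]
    omega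

/-- The growth is at most quadratic; the ratio 3/2 is chosen because it is at most 3/4 * 2^d for
every d ≥ 1. -/
theorem netDepth_le {d : ℕ} (hd : 1 ≤ d) (k : ℕ) : (netDepth d k : ℝ) ≤ 20 * d * (3 / 2) ^ k := by
  induction k with
  | zero => simp [netDepth]
  | succ k ih =>
    have h1 : netDepth d (k + 1) ≤ netDepth d k + 5 * d * (k + 1) := by
      have h2 : (d - 1) * (k + 1) ≤ d * (k + 1) := Nat.mul_le_mul_right _ (Nat.sub_le d 1)
      have h3 : d * 1 ≤ d * (k + 1) := Nat.mul_le_mul_left _ (by omega)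
      simp only [netDepth, logDirections]
      linarith
    have h2 : (netDepth d (k + 1) : ℝ) ≤ netDepth d k + 5 * d * (k + 1) := by exact_mod_cast h1
    have h3 := one_add_mul_le_pow (show (-2 : ℝ) ≤ 1 / 2 by norm_num) k
    norm_num at h3
    have h4 : 5 * (d : ℝ) * (k + 1) ≤ 5 * d * (2 * (3 / 2) ^ k) := by
      gcongr
      linarith
    rw [pow_succ]
    linarith

/-- The subtracted term closes the induction: multiplied by 2^d, its coefficient 3 becomes 4 at the
next power of 3/4 * 2^d, which leaves room for the new directions and the depth. -/
theorem netSize_le {d : ℕ} (hd : 1 ≤ d) (k : ℕ) :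
    (netSize d k : ℝ) ≤ (1 + 3 * (4 ^ d + 20 * d)) * (2 ^ d) ^ k -
      3 * (4 ^ d + 20 * d) * (3 / 4 * 2 ^ d) ^ k := by
  induction k with
  | zero => simp [netSize]
  | succ k ih =>
    have h2d : (2 : ℝ) ^ d = 2 * 2 ^ (d - 1) := by
      rw [← pow_succ', Nat.sub_add_cancel hd]
    have hone : (1 : ℝ) ≤ 2 ^ (d - 1) := one_le_pow₀ one_le_two
    have h1 : netSize d (k + 1) ≤ 2 ^ d * netSize d k + 2 ^ logDirections d (k + 1) +
        netDepth d (k + 1) := by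
      simp only [netDepth, netSize]
      omega
    have h2 : (netSize d (k + 1) : ℝ) ≤ 2 ^ d * netSize d k + 2 ^ logDirections d (k + 1) +
        netDepth d (k + 1) := by exact_mod_cast h1
    have h3 : (2 : ℝ) ^ logDirections d (k + 1) ≤ 4 ^ d * (3 / 4 * 2 ^ d) ^ (k + 1) := by
      rw [logDirections, pow_add, pow_mul, pow_mul 2 2 d, mul_comm]
      norm_num
      gcongr
      linarith
    have h4 : (netDepth d (k + 1) : ℝ) ≤ 20 * d * (3 / 4 * 2 ^ d) ^ (k + 1) := by
      refine (netDepth_le hd (k + 1)).trans ?_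
      gcongr
      linarith
    have h5 : (2 : ℝ) ^ d * netSize d k ≤ 2 ^ d * ((1 + 3 * (4 ^ d + 20 * d)) * (2 ^ d) ^ k -
      3 * (4 ^ d + 20 * d) * (3 / 4 * 2 ^ d) ^ k) := by gcongr
    have h6 : (2 : ℝ) ^ d * (3 / 4 * 2 ^ d) ^ k = 4 / 3 * (3 / 4 * 2 ^ d) ^ (k + 1) := by
      rw [pow_succ]; ring
    have h7 : (2 : ℝ) ^ d * (2 ^ d) ^ k = (2 ^ d) ^ (k + 1) := (pow_succ' _ _).symm
    rw [mul_sub, mul_left_comm, h7, mul_left_comm (2 ^ d : ℝ), h6] at h5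
    linarith

theorem exists_netSize_le {d : ℕ} (hd : 1 ≤ d) :
    ∃ B : ℕ, 1 ≤ B ∧ ∀ n, 6 * (d + 3) * netSize d n ≤ B * (2 ^ d) ^ n := by
  refine ⟨6 * (d + 3) * (1 + 3 * (4 ^ d + 20 * d)), Nat.mul_pos (by omega) (by omega), fun n => ?_⟩
  rw [mul_assoc (6 * (d + 3))]
  refine Nat.mul_le_mul_left _ ?_
  have h1 : (0 : ℝ) ≤ 3 * (4 ^ d + 20 * d) * (3 / 4 * 2 ^ d) ^ n := by positivity
  have h2 : (netSize d n : ℝ) ≤ (1 + 3 * (4 ^ d + 20 * d)) * (2 ^ d) ^ n := by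
    linarith [netSize_le hd n]
  exact_mod_cast h2

theorem exists_lipschitz_extension {X : Type*} [PseudoMetricSpace X] {s : Set X} {f : s → ℝ}
    (hf : LipschitzWith 1 f) : ∃ g : X → ℝ, LipschitzWith 1 g ∧ ∀ x : s, g x = f x := by
  have h : ∀ x : s, Function.extend Subtype.val f 0 (x : X) = f x := fun x =>
    Subtype.val_injective.extend_apply f 0 x
  obtain ⟨g, hg, heq⟩ := LipschitzOnWith.extend_real (f := Function.extend Subtype.val f 0)
    (s := s) (K := 1) (by
      rw [lipschitzOnWith_iff_restrict]
      convert hf using 1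
      exact funext h)
  exact ⟨g, hg, fun x => (heq x.2).symm.trans (h x)⟩

/-- Up to constants, Lipschitz functions on the cube are approximated by Lipschitz networks with
`S` parameters, with an error of order `S ^ (-1 / d)`. -/
theorem exists_dnnLipClass_near {d : ℕ} (hd : 1 ≤ d) :
    ∃ B : ℕ, 1 ≤ B ∧ ∀ S : ℕ, 1 ≤ S → ∃ L n : ℕ, L ≤ S ∧ S < B * (2 ^ d) ^ (n + 1) ∧
      (dnnLipClass d L S).Nonempty ∧ ∀ f : unitCube d → ℝ, LipschitzWith 1 f →
        ∃ g ∈ dnnLipClass d L S, ∃ r : ℝ, ∀ x, |g x - (f x - r)| ≤ 144 * d ^ 2 * (1 / 2 ^ n) := by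
  obtain ⟨B, hB, hsize⟩ := exists_netSize_le hd
  refine ⟨B, hB, fun S hS => ?_⟩
  have hb : 1 < 2 ^ d := Nat.one_lt_two_pow (by omega)
  have hup : S < B * (2 ^ d) ^ (Nat.log (2 ^ d) (S / B) + 1) := by
    have := Nat.lt_pow_succ_log_self hb (S / B)
    rwa [Nat.div_lt_iff_lt_mul hB, mul_comm] at this
  obtain ⟨n, hn⟩ : ∃ n, n = Nat.log (2 ^ d) (S / B) := ⟨_, rfl⟩
  rw [← hn] at hup
  cases n with
  | zero =>
    -- For small `S` the zero network is good enough once f 0 is subtracted. It has one hidden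
    -- layer, since padding needs hidden neurons.
    have h0 : (0 : EuclideanSpace ℝ (Fin d)) ∈ unitCube d := fun i => by simp
    refine ⟨1, 0, hS, hup, ⟨_, zero_mem_dnnLipClass 0 S⟩, fun f hf =>
      ⟨_, zero_mem_dnnLipClass 0 S, f ⟨0, h0⟩, fun x => ?_⟩⟩
    have h1 := hf.dist_le_mul x ⟨0, h0⟩
    have h2 : ‖(x : EuclideanSpace ℝ (Fin d)) - 0‖ ≤ √d * 1 :=
      norm_sub_le_of_mem_cornerCube zero_le_one fun i => by simpa using x.2 i
    rw [NNReal.coe_one, one_mul, Subtype.dist_eq, Real.dist_eq, dist_eq_norm] at h1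
    have hd1 : (1 : ℝ) ≤ d := by exact_mod_cast hd
    have hs1 : 1 ≤ √(d : ℝ) := Real.one_le_sqrt.2 hd1
    have hs2 : √(d : ℝ) ^ 2 = d := Real.sq_sqrt (by linarith)
    have hs3 : √(d : ℝ) ≤ d ^ 2 := by nlinarith
    rw [zero_sub, abs_neg, pow_zero, div_one, mul_one]
    refine h1.trans (h2.trans ?_)
    nlinarith
  | succ n =>
    have hSB : S / B ≠ 0 := fun h => by simp [h] at hn
    have hlow : B * (2 ^ d) ^ (n + 1) ≤ S := by
      have := Nat.pow_log_le_self (2 ^ d) hSB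
      rw [← hn, Nat.le_div_iff_mul_le hB] at this
      rwa [mul_comm]
    have hS' : 6 * (d + 3) * netSize d (n + 1) ≤ S := (hsize (n + 1)).trans hlow
    obtain ⟨L, hL⟩ : ∃ L, netDepth d (n + 1) = L + 1 := ⟨_, rfl⟩
    refine ⟨L + 1, n + 1, ?_, hup, ⟨_, zero_mem_dnnLipClass L S⟩, fun f hf => ?_⟩
    · rw [← hL]
      refine (netDepth_le_netSize d (n + 1)).trans (le_trans ?_ hS')
      exact Nat.le_mul_of_pos_left _ (by omega)
    · obtain ⟨f', hf', hff'⟩ := exists_lipschitz_extension hf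
      obtain ⟨F, hF, hnear⟩ := exists_lipNet_near hd hf' (n + 1)
      rw [hL] at hF
      refine ⟨_, hF.mem_dnnLipClass hS', 0, fun x => ?_⟩
      rw [sub_zero, ← hff']
      exact hnear x x.2

theorem one_div_two_pow_le {d S B n : ℕ} (hd : 1 ≤ d) (hS : 1 ≤ S) (hB : 1 ≤ B)
    (h : S < B * (2 ^ d) ^ (n + 1)) :
    (1 : ℝ) / 2 ^ n ≤ 2 * B * (S : ℝ) ^ (-(1 / (d : ℝ))) := by
  have hS0 : (0 : ℝ) < S := by exact_mod_cast hS
  have h1 : (S : ℝ) ≤ (B * 2 ^ (n + 1)) ^ d := by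
    -- B ≤ B^d lets the right side be a full power, so taking the root costs at most a factor `B`.
    have h2 : B * (2 ^ d) ^ (n + 1) ≤ (B * 2 ^ (n + 1)) ^ d := by
      rw [mul_pow, ← pow_mul, ← pow_mul, mul_comm d]
      exact Nat.mul_le_mul_right _ (Nat.le_self_pow (by omega) B)
    exact_mod_cast h.le.trans h2
  have h3 : (S : ℝ) ^ (1 / (d : ℝ)) ≤ B * 2 ^ (n + 1) := by
    rw [one_div, Real.rpow_inv_le_iff_of_pos hS0.le (by positivity) (by exact_mod_cast hd),
      Real.rpow_natCast]
    exact h1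
  have h4 : 0 < (S : ℝ) ^ (1 / (d : ℝ)) := Real.rpow_pos_of_pos hS0 _
  rw [Real.rpow_neg hS0.le, ← div_eq_mul_inv, div_le_div_iff₀ (by positivity) h4, one_mul]
  calc _ ≤ _ := h3
    _ = _ := by ring

theorem isCompact_unitCube (d : ℕ) : IsCompact (unitCube d) := by
  have := isCompact_cornerCube (0 : EuclideanSpace ℝ (Fin d)) zero_le_one
  simpa [cornerCube, unitCube] using this

/-- The dual supremum over a class of Lipschitz networks is as close to the Wasserstein distance as
the class is, up to constants, to the Lipschitz functions. -/
theorem abs_dnnWasserstein_sub_le {d L S : ℕ} {η : ℝ} (hη : 0 < η)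
    (hne : (dnnLipClass d L S).Nonempty)
    (h : ∀ f : unitCube d → ℝ, LipschitzWith 1 f →
      ∃ g ∈ dnnLipClass d L S, ∃ r : ℝ, ∀ x, |g x - (f x - r)| ≤ η)
    (μ₁ μ₂ : Measure (unitCube d)) [IsProbabilityMeasure μ₁] [IsProbabilityMeasure μ₂] :
    |dnnWasserstein L S μ₁ μ₂ - wasserstein μ₁ μ₂| ≤ 3 * η := by
  have : CompactSpace (unitCube d) := isCompact_iff_compactSpace.1 (isCompact_unitCube d)
  have hle : ∀ f ∈ dnnLipClass d L S,
      ∫ x, f x ∂μ₂ - ∫ x, f x ∂μ₁ ≤ wasserstein μ₁ μ₂ := fun f hf =>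
    integral_sub_integral_le_wasserstein μ₁ μ₂ hf.1
  have hup : dnnWasserstein L S μ₁ μ₂ ≤ wasserstein μ₁ μ₂ := by
    refine csSup_le (hne.image _) ?_
    rintro _ ⟨f, hf, rfl⟩
    exact hle f hf
  -- The potential is optimal up to η and each of the two integrals moves by at most η, whence 3η;
  -- the constant `r` cancels because both measures have mass one.
  obtain ⟨f, hf, hW⟩ := exists_lipschitz_wasserstein_le μ₁ μ₂ hη
  obtain ⟨g, hg, r, hgf⟩ := h f hf
  have hlow : ∫ x, g x ∂μ₂ - ∫ x, g x ∂μ₁ ≤ dnnWasserstein L S μ₁ μ₂ :=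
    le_csSup ⟨wasserstein μ₁ μ₂, by rintro _ ⟨f, hf, rfl⟩; exact hle f hf⟩ ⟨g, hg, rfl⟩
  have hi : ∀ (e : unitCube d → ℝ), LipschitzWith 1 e → ∀ (μ : Measure (unitCube d))
      [IsFiniteMeasure μ], Integrable e μ := fun e he μ _ =>
    ContinuousMap.integrable_of_isFiniteMeasure μ ⟨e, he.continuous⟩
  have h1 := integral_mono (hi g hg.1 μ₁) ((hi f hf μ₁).add (integrable_const (η - r)))
    (fun x => by have := (abs_le.1 (hgf x)).2; change g x ≤ f x + (η - r); linarith)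
  have h2 := integral_mono ((hi f hf μ₂).add (integrable_const (-η - r))) (hi g hg.1 μ₂)
    (fun x => by have := (abs_le.1 (hgf x)).1; change f x + (-η - r) ≤ g x; linarith)
  simp only [Pi.add_apply] at h1 h2
  rw [integral_add (hi f hf μ₁) (integrable_const _), integral_const, probReal_univ, one_smul] at h1
  rw [integral_add (hi f hf μ₂) (integrable_const _), integral_const, probReal_univ, one_smul] at h2
  rw [abs_le]
  constructor <;> linarith

end Rate

end

theorem lemma1 :
    ∃ C : ℝ, 0 < C ∧ ∀ d : ℕ, 1 ≤ d → ∃ c : ℝ, 0 < c ∧ ∀ S : ℕ, 1 ≤ S →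
      ∃ L : ℕ, (L : ℝ) ≤ C * ((1 + (S : ℝ)) * (1 + 1 / (d : ℝ))) ∧
        (dnnLipClass d L S).Nonempty ∧
        ∀ (μ₁ μ₂ : Measure (unitCube d)) [IsProbabilityMeasure μ₁] [IsProbabilityMeasure μ₂],
          |dnnWasserstein L S μ₁ μ₂ - wasserstein μ₁ μ₂| ≤ c * (S : ℝ) ^ (-(1 / (d : ℝ))) := by
  refine ⟨1, one_pos, fun d hd => ?_⟩
  obtain ⟨B, hB, hnear⟩ := exists_dnnLipClass_near hd
  have hd0 : (0 : ℝ) < d := by exact_mod_cast hd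
  have hB0 : (0 : ℝ) < B := by exact_mod_cast hB
  refine ⟨3 * (144 * d ^ 2 * (2 * B)), by positivity, fun S hS => ?_⟩
  obtain ⟨L, n, hLS, hSn, hne, happrox⟩ := hnear S hS
  refine ⟨L, ?_, hne, fun μ₁ μ₂ _ _ => ?_⟩
  · have h1 : (L : ℝ) ≤ S := by exact_mod_cast hLS
    have h2 : (0 : ℝ) ≤ (1 + S) * (1 / d) := by positivity
    rw [one_mul, mul_add, mul_one]
    linarith
  · refine (abs_dnnWasserstein_sub_le (by positivity) hne happrox μ₁ μ₂).trans ?_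
    rw [mul_assoc 3, mul_assoc (144 * (d : ℝ) ^ 2)]
    gcongr
    exact one_div_two_pow_le hd hS hB hSn
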